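/- Let $\mathcal C$ be a symmetric monoidal category and let $(X,\mu,\eta,\delta,\epsilon)$ be a commutative and cocommutative bialgebra in $\mathcal C$: $(X,\mu,\eta)$ is a commutative monoid, $(X,\delta,\epsilon)$ is a cocommutative comonoid, and $$\delta\circ\mu=(\mu\otimes\mu)\circ(1_X\otimes\sigma_{X,X}\otimes 1_X)\circ(\delta\otimes\delta),\qquad \delta\circ\eta=\eta\otimes\eta,\qquad \epsilon\circ\mu=\epsilon\otimes\epsilon,\qquad \epsilon\circ\eta=1_I$$ (up to the canonical associativity and unit isomorphisms). Consider diagrams with $m$ inputs and $n$ outputs built by sequential and parallel composition from $\mu$, $\eta$, $\delta$, $\epsilon$, identity wires on $X$ and swaps $\sigma_{X,X}$; each such diagram denotes a morphism $X^{\otimes m}\to X^{\otimes n}$. The characteristic matrix of a diagram is the $m\times n$ matrix of natural numbers whose $(i,j)$ entry is the number of forward-directed paths in the diagram from the $i$-th input to the $j$-th output. If two such diagrams with $m$ inputs and $n$ outputs have the same characteristic matrix, then the morphisms $X^{\otimes m}\to X^{\otimes n}$ that they denote are equal. -/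

import Mathlib

open CategoryTheory MonoidalCategory

universe v u

/-- Diagrams with `m` inputs and `n` outputs over a single system, built from multiplication,
unit, comultiplication and counit dots, identities (bundles of `n` plain wires; `id 0` is the empty
diagram) and swaps, by sequential composition (`comp d e` is `d` followed by `e`) and parallel
juxtaposition. -/
inductive BialgDiagram : ℕ → ℕ → Type
  | id (n : ℕ) : BialgDiagram n n
  | swap : BialgDiagram 2 2
  | mul : BialgDiagram 2 1
  | unit : BialgDiagram 0 1
  | comul : BialgDiagram 1 2
  | counit : BialgDiagram 1 0
  | comp {k m n : ℕ} (d : BialgDiagram k m) (e : BialgDiagram m n) : BialgDiagram k n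
  | tensor {m n m' n' : ℕ} (d : BialgDiagram m n) (e : BialgDiagram m' n') :
      BialgDiagram (m + m') (n + n')

namespace BialgDiagram

/-! ### The directed graph of a diagram, and the characteristic matrix -/

/-- Marked points on the wires of a diagram: each elementary piece has one point for each of its
inputs and one for each of its outputs. -/
def Vertex : {m n : ℕ} → BialgDiagram m n → Type
  | _, _, .id n => Fin n ⊕ Fin n
  | _, _, .swap => Fin 2 ⊕ Fin 2
  | _, _, .mul => Fin 2 ⊕ Fin 1
  | _, _, .unit => Fin 0 ⊕ Fin 1
  | _, _, .comul => Fin 1 ⊕ Fin 2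
  | _, _, .counit => Fin 1 ⊕ Fin 0
  | _, _, .comp d e => Vertex d ⊕ Vertex e
  | _, _, .tensor d e => Vertex d ⊕ Vertex e

/-- The point at the `i`-th input of a diagram. -/
def input : {m n : ℕ} → (d : BialgDiagram m n) → Fin m → Vertex d
  | _, _, .id _ => Sum.inl
  | _, _, .swap => Sum.inl
  | _, _, .mul => Sum.inl
  | _, _, .unit => Sum.inl
  | _, _, .comul => Sum.inl
  | _, _, .counit => Sum.inl
  | _, _, .comp d _ => fun i => Sum.inl (input d i)
  | _, _, .tensor d e => Fin.addCases (fun i => Sum.inl (input d i)) (fun i => Sum.inr (input e i))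

/-- The point at the `j`-th output of a diagram. -/
def output : {m n : ℕ} → (d : BialgDiagram m n) → Fin n → Vertex d
  | _, _, .id _ => Sum.inr
  | _, _, .swap => Sum.inr
  | _, _, .mul => Sum.inr
  | _, _, .unit => Sum.inr
  | _, _, .comul => Sum.inr
  | _, _, .counit => Sum.inr
  | _, _, .comp _ e => fun j => Sum.inr (output e j)
  | _, _, .tensor d e =>
      Fin.addCases (fun j => Sum.inl (output d j)) (fun j => Sum.inr (output e j))

/-- The directed edges of the graph of a diagram. A plain wire joins its two ends, a swap joins its
inputs to its outputs crosswise, and a dot joins each of its inputs to each of its outputs.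
In a composite the `k`-th output of the first diagram is joined to the `k`-th input of the second;
juxtaposition is disjoint union. -/
def Adj : {m n : ℕ} → (d : BialgDiagram m n) → Vertex d → Vertex d → Prop
  | _, _, .id n => fun x y => ∃ i : Fin n, x = Sum.inl i ∧ y = Sum.inr i
  | _, _, .swap => fun x y => ∃ i : Fin 2, x = Sum.inl i ∧ y = Sum.inr (Fin.rev i)
  | _, _, .mul => fun x y => ∃ (i : Fin 2) (j : Fin 1), x = Sum.inl i ∧ y = Sum.inr j
  | _, _, .unit => fun x y => ∃ (i : Fin 0) (j : Fin 1), x = Sum.inl i ∧ y = Sum.inr j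
  | _, _, .comul => fun x y => ∃ (i : Fin 1) (j : Fin 2), x = Sum.inl i ∧ y = Sum.inr j
  | _, _, .counit => fun x y => ∃ (i : Fin 1) (j : Fin 0), x = Sum.inl i ∧ y = Sum.inr j
  | _, _, .comp d e => fun x y =>
      (∃ a b, Adj d a b ∧ x = Sum.inl a ∧ y = Sum.inl b) ∨
      (∃ a b, Adj e a b ∧ x = Sum.inr a ∧ y = Sum.inr b) ∨
      (∃ k, x = Sum.inl (output d k) ∧ y = Sum.inr (input e k))
  | _, _, .tensor d e => fun x y =>
      (∃ a b, Adj d a b ∧ x = Sum.inl a ∧ y = Sum.inl b) ∨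
      (∃ a b, Adj e a b ∧ x = Sum.inr a ∧ y = Sum.inr b)

/-- The points of a diagram, as the vertices of its directed graph. -/
structure Point {m n : ℕ} (d : BialgDiagram m n) where
  /-- The underlying marked point. -/
  pt : Vertex d

/-- The directed graph of a diagram: at most one edge from a point to another, given by `Adj`. -/
instance quiverPoint {m n : ℕ} (d : BialgDiagram m n) : Quiver (Point d) where
  Hom x y := PLift (Adj d x.pt y.pt)

/-- The characteristic matrix: the `(i, j)` entry is the number of forward-directed paths from the
`i`-th input to the `j`-th output. (The graph is finite and acyclic, so this number is finite.) -/
noncomputable def charMatrix {m n : ℕ} (d : BialgDiagram m n) : Matrix (Fin m) (Fin n) ℕ :=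
  Matrix.of fun i j =>
    Nat.card (Quiver.Path (Point.mk (input d i)) (Point.mk (output d j)))

/-! ### The map denoted by a diagram -/

section Eval

variable {C : Type u} [Category.{v} C] [MonoidalCategory C]

/-- The `n`-fold tensor power `(⋯((I ⊗ X) ⊗ X) ⋯) ⊗ X`. -/
def tpow (X : C) : ℕ → C
  | 0 => 𝟙_ C
  | n + 1 => tpow X n ⊗ X

/-- The canonical (associativity and unit) isomorphism `X^(m+n) ≅ X^m ⊗ X^n`. -/
def tpowAdd (X : C) (m : ℕ) : (n : ℕ) → (tpow X (m + n) ≅ tpow X m ⊗ tpow X n)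
  | 0 => (ρ_ (tpow X m)).symm
  | n + 1 => whiskerRightIso (tpowAdd X m n) X ≪≫ α_ (tpow X m) (tpow X n) X

/-- The canonical isomorphism `X^1 ≅ X`. -/
def tpowOne (X : C) : tpow X 1 ≅ X := λ_ X

/-- The canonical isomorphism `X^2 ≅ X ⊗ X`. -/
def tpowTwo (X : C) : tpow X 2 ≅ X ⊗ X := whiskerRightIso (λ_ X) X

/-- The map `X^m ⟶ X^n` denoted by a diagram, for a bialgebra `X` in a symmetric monoidal
category. -/
def eval [SymmetricCategory C] (X : C) [BimonObj X] :
    {m n : ℕ} → BialgDiagram m n → (tpow X m ⟶ tpow X n)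
  | _, _, .id n => 𝟙 (tpow X n)
  | _, _, .swap => (tpowTwo X).hom ≫ (β_ X X).hom ≫ (tpowTwo X).inv
  | _, _, .mul => (tpowTwo X).hom ≫ MonObj.mul (X := X) ≫ (tpowOne X).inv
  | _, _, .unit => MonObj.one (X := X) ≫ (tpowOne X).inv
  | _, _, .comul => (tpowOne X).hom ≫ ComonObj.comul (X := X) ≫ (tpowTwo X).inv
  | _, _, .counit => (tpowOne X).hom ≫ ComonObj.counit (X := X)
  | _, _, .comp d e => eval X d ≫ eval X e
  | _, _, .tensor (m := m) (n := n) (m' := m') (n' := n') d e =>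
      (tpowAdd X m m').hom ≫ (eval X d ⊗ₘ eval X e) ≫ (tpowAdd X n n').inv

end Eval

end BialgDiagram

/-! Among comonoids and comonoid morphisms the tensor product has projections, obtained by
discarding a factor with the counit, and a comonoid morphism into `A ⊗ B` is determined by its two
components. Hence a comonoid morphism into `X^n` is determined by its `n` components in `X`. Every
diagram denotes a comonoid morphism: for μ and η this is the bialgebra axioms, for δ it is
cocommutativity.

Since `X` is commutative and `X^m` cocommutative, the morphisms `X^m ⟶ X` form a commutative monoid
under convolution. In it the `j`-th component of the value of a diagram with characteristic matrix
`M` is `∏ i, p_i ^ M i j`, with `p_i` the projections (`of_eval_comp_tpowProj`). This is an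
induction on the diagram. Precomposition with a comonoid morphism preserves convolution, so stacking
diagrams multiplies matrices, and path counting does the same because a path crosses exactly one
middle wire. The matrix thus determines all components, hence the morphism. -/

namespace CategoryTheory

open CategoryTheory.MonObj ComonObj

/-! ### Projections from a tensor product of comonoids -/

section Monoidal

variable {C : Type u} [Category.{v} C] [MonoidalCategory C]

/-- The first projection from a tensor product of comonoids. -/
def comonFst (A B : C) [ComonObj B] : A ⊗ B ⟶ A := A ◁ ε[B] ≫ (ρ_ A).hom

/-- The second projection from a tensor product of comonoids. -/
def comonSnd (A B : C) [ComonObj A] : A ⊗ B ⟶ B := ε[A] ▷ B ≫ (λ_ B).hom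

theorem tensorHom_comonFst {A B A' B' : C} [ComonObj B] [ComonObj B'] (f : A ⟶ A') (g : B ⟶ B')
    [IsComonHom g] : (f ⊗ₘ g) ≫ comonFst A' B' = comonFst A B ≫ f := by
  rw [comonFst, comonFst, MonoidalCategory.tensorHom_def, Category.assoc, ← whiskerLeft_comp_assoc,
    IsComonHom.hom_counit, ← whisker_exchange_assoc, rightUnitor_naturality, Category.assoc]

theorem tensorHom_comonSnd {A B A' B' : C} [ComonObj A] [ComonObj A'] (f : A ⟶ A') (g : B ⟶ B')
    [IsComonHom f] : (f ⊗ₘ g) ≫ comonSnd A' B' = comonSnd A B ≫ g := by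
  rw [comonSnd, comonSnd, tensorHom_def', Category.assoc, ← comp_whiskerRight_assoc,
    IsComonHom.hom_counit, whisker_exchange_assoc, leftUnitor_naturality, Category.assoc]

theorem tensorHom_comonFst_assoc {A B A' B' Z : C} [ComonObj B] [ComonObj B'] (f : A ⟶ A')
    (g : B ⟶ B') [IsComonHom g] (h : A' ⟶ Z) :
    (f ⊗ₘ g) ≫ comonFst A' B' ≫ h = comonFst A B ≫ f ≫ h := by
  rw [← Category.assoc, tensorHom_comonFst, Category.assoc]

theorem tensorHom_comonSnd_assoc {A B A' B' Z : C} [ComonObj A] [ComonObj A'] (f : A ⟶ A')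
    (g : B ⟶ B') [IsComonHom f] (h : B' ⟶ Z) :
    (f ⊗ₘ g) ≫ comonSnd A' B' ≫ h = comonSnd A B ≫ g ≫ h := by
  rw [← Category.assoc, tensorHom_comonSnd, Category.assoc]

end Monoidal

/-! ### Comonoid morphisms and joint monicity of the projections -/

section Braided

variable {C : Type u} [Category.{v} C] [MonoidalCategory C] [BraidedCategory C]

attribute [local instance] ComonObj.instTensorUnit

instance IsComonHom.tensorHom {A B A' B' : C} [ComonObj A] [ComonObj B] [ComonObj A'] [ComonObj B']
    (f : A ⟶ A') (g : B ⟶ B') [IsComonHom f] [IsComonHom g] : IsComonHom (f ⊗ₘ g) where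
  hom_counit := by simp
  hom_comul := by
    rw [Comon.tensorObj_comul, Comon.tensorObj_comul, tensorHom_comp_tensorHom_assoc,
      IsComonHom.hom_comul, IsComonHom.hom_comul, ← tensorHom_comp_tensorHom_assoc,
      tensorμ_natural, Category.assoc]

/-- Inherited from the monoidal category `Comon C`, whose associator is a comonoid morphism by
construction and has the associator of `C` underneath. The unitors below are treated alike. -/
instance IsComonHom.associator_hom (A B D : C) [ComonObj A] [ComonObj B] [ComonObj D] :
    IsComonHom (α_ A B D).hom := by
  have h : IsComonHom (α_ (Comon.mk A) (Comon.mk B) (Comon.mk D)).hom.hom := inferInstance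
  have e : (α_ (Comon.mk A) (Comon.mk B) (Comon.mk D)).hom.hom = (α_ A B D).hom := by
    rw [Comon.monoidal_associator_hom_hom]
    change 𝟙 (A ⊗ B) ▷ D ≫ (α_ A B D).hom ≫ A ◁ 𝟙 (B ⊗ D) = (α_ A B D).hom
    simp
  exact e ▸ h

instance IsComonHom.leftUnitor_hom (A : C) [ComonObj A] : IsComonHom (λ_ A).hom := by
  have h : IsComonHom (λ_ (Comon.mk A)).hom.hom := inferInstance
  have e : (λ_ (Comon.mk A)).hom.hom = (λ_ A).hom := by
    rw [Comon.monoidal_leftUnitor_hom_hom]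
    change 𝟙 (𝟙_ C) ▷ A ≫ (λ_ A).hom = (λ_ A).hom
    simp
  exact e ▸ h

instance IsComonHom.rightUnitor_hom (A : C) [ComonObj A] : IsComonHom (ρ_ A).hom := by
  have h : IsComonHom (ρ_ (Comon.mk A)).hom.hom := inferInstance
  have e : (ρ_ (Comon.mk A)).hom.hom = (ρ_ A).hom := by
    rw [Comon.monoidal_rightUnitor_hom_hom]
    change A ◁ 𝟙 (𝟙_ C) ≫ (ρ_ A).hom = (ρ_ A).hom
    simp
  exact e ▸ h

instance IsComonHom.counit (A : C) [ComonObj A] : IsComonHom ε[A] :=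
  inferInstanceAs (IsComonHom (default : Comon.mk A ⟶ Comon.trivial C).hom)

instance IsComonHom.mul (X : C) [BimonObj X] : IsComonHom μ[X] where
  hom_counit := by simp
  hom_comul := by simp

instance IsComonHom.one (X : C) [BimonObj X] : IsComonHom η[X] where
  hom_counit := by simp
  hom_comul := by simp [MonObj.tensorObj.one_def]

instance (A B : C) [ComonObj A] [ComonObj B] : IsComonHom (comonFst A B) := by
  rw [comonFst, ← id_tensorHom]; infer_instance

instance (A B : C) [ComonObj A] [ComonObj B] : IsComonHom (comonSnd A B) := by
  rw [comonSnd, ← tensorHom_id]; infer_instance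

/-- The counits slide back through the middle exchange `tensorμ` onto the two comultiplications,
where the counit laws cancel them; only coherence isomorphisms remain. -/
theorem comul_comonFst_comonSnd (A B : C) [ComonObj A] [ComonObj B] :
    Δ[A ⊗ B] ≫ (comonFst A B ⊗ₘ comonSnd A B) = 𝟙 (A ⊗ B) := by
  have h : (comonFst A B ⊗ₘ comonSnd A B) =
    ((𝟙 A ⊗ₘ ε[B]) ⊗ₘ (ε[A] ⊗ₘ 𝟙 B)) ≫ ((ρ_ A).hom ⊗ₘ (λ_ B).hom) := by
    simp [comonFst, comonSnd]
  rw [h, Comon.tensorObj_comul, Category.assoc, ← tensorμ_natural_assoc,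
    tensorHom_comp_tensorHom_assoc, comul_counit_hom, counit_comul_hom]
  simp only [tensorμ, braiding_tensorUnit_left]
  monoidal

/-- The uniqueness half of the universal property of a product: a comonoid morphism is recovered by
duplicating its source and applying its two components. -/
theorem IsComonHom.hom_ext_tensor {A B D : C} [ComonObj A] [ComonObj B] [ComonObj D]
    {f g : D ⟶ A ⊗ B} [IsComonHom f] [IsComonHom g]
    (h₁ : f ≫ comonFst A B = g ≫ comonFst A B) (h₂ : f ≫ comonSnd A B = g ≫ comonSnd A B) :
    f = g := by
  have key (k : D ⟶ A ⊗ B) [IsComonHom k] :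
      k = Δ[D] ≫ ((k ≫ comonFst A B) ⊗ₘ (k ≫ comonSnd A B)) := by
    rw [← tensorHom_comp_tensorHom, ← IsComonHom.hom_comul_assoc, comul_comonFst_comonSnd,
      Category.comp_id]
  rw [key f, key g, h₁, h₂]

end Braided

/-! ### Braiding and comultiplication as comonoid morphisms -/

section Symm

variable {C : Type u} [Category.{v} C] [MonoidalCategory C] [SymmetricCategory C]

theorem braiding_tensorμ (A B : C) :
    (β_ (A ⊗ A) (B ⊗ B)).hom ≫ tensorμ B B A A =
      tensorμ A A B B ≫ ((β_ A B).hom ⊗ₘ (β_ A B).hom) := by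
  simp only [tensorμ, Category.assoc,
    BraidedCategory.braiding_tensor_right_hom, BraidedCategory.braiding_tensor_left_hom,
    comp_whiskerRight, whisker_assoc, whiskerLeft_comp, pentagon_assoc,
    pentagon_inv_hom_hom_hom_inv_assoc, Iso.inv_hom_id_assoc, whiskerLeft_hom_inv_assoc]
  -- Symmetry enters here: the crossing from `tensorμ` on the left undoes one of the crossings of
  -- the block braiding.
  rw [MonoidalCategory.tensorHom_def, SymmetricCategory.braiding_swap_eq_inv_braiding A B]; simp

instance IsComonHom.braiding_hom (A B : C) [ComonObj A] [ComonObj B] : IsComonHom (β_ A B).hom where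
  hom_counit := by
    rw [Comon.tensorObj_counit, Comon.tensorObj_counit,
      ← BraidedCategory.braiding_naturality_assoc, braiding_leftUnitor, unitors_equal]
  hom_comul := by
    rw [Comon.tensorObj_comul, Comon.tensorObj_comul, ← BraidedCategory.braiding_naturality_assoc,
      braiding_tensorμ, Category.assoc]

/-- By coassociativity the two middle strands of the fourfold comultiplication can be taken to come
from a single `Δ`, which absorbs their swap by cocommutativity. -/
theorem comul_comul_tensorμ (A : C) [ComonObj A] [IsCommComonObj A] :
    Δ[A] ≫ (Δ[A] ⊗ₘ Δ[A]) ≫ tensorμ A A A A = Δ[A] ≫ (Δ[A] ⊗ₘ Δ[A]) := by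
  have h : Δ[A] ≫ (Δ[A] ⊗ₘ Δ[A]) = Δ[A] ≫ A ◁ (Δ[A] ≫ A ◁ Δ[A]) ≫ (α_ A A (A ⊗ A)).inv := by
    rw [MonoidalCategory.tensorHom_def, MonoidalCategory.whiskerLeft_comp, Category.assoc,
      comul_assoc_assoc, tensor_whiskerLeft]
  rw [reassoc_of% h, h, tensorμ, Iso.inv_hom_id_assoc]
  simp only [← whiskerLeft_comp_assoc, Category.assoc, ComonObj.comul_assoc, Iso.hom_inv_id_assoc]
  rw [← comp_whiskerRight_assoc, IsCommComonObj.comul_comm]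

instance IsComonHom.comul (A : C) [ComonObj A] [IsCommComonObj A] : IsComonHom Δ[A] where
  hom_counit := by simp [unitors_equal]
  hom_comul := by rw [Comon.tensorObj_comul, comul_comul_tensorμ]

end Symm
-- The convolution monoid
namespace Conv

variable {C : Type u} [Category.{v} C] [MonoidalCategory C]

/-- A morphism, as an element of the convolution monoid. -/
def of {M N : C} (f : M ⟶ N) : Conv M N := f

variable {M N : C} [ComonObj M] [MonObj N]

theorem of_mul_of (f g : M ⟶ N) : of f * of g = of (Δ[M] ≫ (f ⊗ₘ g) ≫ μ[N]) := by
  rw [MonoidalCategory.tensorHom_def, Category.assoc]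
  rfl

/-- Precomposition with a comonoid morphism, as a homomorphism of convolution monoids. -/
def precomp {A B : C} [ComonObj A] [ComonObj B] (f : A ⟶ B) [IsComonHom f] (N : C) [MonObj N] :
    Conv B N →* Conv A N where
  toFun g := of (f ≫ g)
  map_one' := IsComonHom.hom_counit_assoc f _
  map_mul' g h := by
    have key (g h : B ⟶ N) : of (f ≫ (Δ[B] ≫ (g ⊗ₘ h) ≫ μ[N])) = of (f ≫ g) * of (f ≫ h) := by
      rw [of_mul_of, IsComonHom.hom_comul_assoc, tensorHom_comp_tensorHom_assoc]
    exact (congrArg (fun k : B ⟶ N => of (f ≫ k))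
      (of_mul_of (M := B) (N := N) g h)).trans (key g h)

theorem precomp_of {A B : C} [ComonObj A] [ComonObj B] (f : A ⟶ B) [IsComonHom f] (g : B ⟶ N) :
    precomp f N (of g) = of (f ≫ g) := rfl

instance [BraidedCategory C] [IsCommComonObj M] [IsCommMonObj N] : CommMonoid (Conv M N) where
  mul_comm f g := by
    have key (f g : M ⟶ N) : of f * of g = of g * of f := by
      rw [of_mul_of, of_mul_of, ← IsCommComonObj.comul_comm_assoc M,
        ← BraidedCategory.braiding_naturality_assoc, IsCommMonObj.mul_comm]
    exact key f g

end Conv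

/-! ### Projections and the associator -/

section Projections

variable {C : Type u} [Category.{v} C] [MonoidalCategory C]

theorem associator_hom_comonSnd_comonFst (A B D : C) [ComonObj A] [ComonObj D] :
    (α_ A B D).hom ≫ comonSnd A (B ⊗ D) ≫ comonFst B D = comonFst (A ⊗ B) D ≫ comonSnd A B := by
  rw [comonFst, comonFst, comonSnd, comonSnd]
  have h : (A ⊗ B) ◁ ε[D] ≫ (ρ_ (A ⊗ B)).hom ≫ ε[A] ▷ B =
      ε[A] ▷ B ▷ D ≫ (𝟙_ C ⊗ B) ◁ ε[D] ≫ (ρ_ (𝟙_ C ⊗ B)).hom := by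
    rw [← rightUnitor_naturality, whisker_exchange_assoc]
  simp only [Category.assoc]
  rw [reassoc_of% h]
  monoidal

variable [BraidedCategory C]

theorem associator_hom_comonFst (A B D : C) [ComonObj B] [ComonObj D] :
    (α_ A B D).hom ≫ comonFst A (B ⊗ D) = comonFst (A ⊗ B) D ≫ comonFst A B := by
  rw [comonFst, comonFst, comonFst, Comon.tensorObj_counit, MonoidalCategory.tensorHom_def']
  monoidal

theorem associator_hom_comonSnd_comonSnd (A B D : C) [ComonObj A] [ComonObj B] :
    (α_ A B D).hom ≫ comonSnd A (B ⊗ D) ≫ comonSnd B D = comonSnd (A ⊗ B) D := by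
  rw [comonSnd, comonSnd, comonSnd, Comon.tensorObj_counit, MonoidalCategory.tensorHom_def]
  monoidal

end Projections

end CategoryTheory

/-! ### Tensor powers, their projections, and diagrams as comonoid morphisms -/

namespace BialgDiagram

open CategoryTheory.MonObj ComonObj

section Defs

variable {C : Type u} [Category.{v} C] [MonoidalCategory C]

/-- The defining decomposition of `X^(n+1)`. -/
def tpowSucc (X : C) (n : ℕ) : tpow X (n + 1) ≅ tpow X n ⊗ X := Iso.refl _

/-- The defining description of `X^0`. -/
def tpowZero (X : C) : tpow X 0 ≅ 𝟙_ C := Iso.refl _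

/-- This and the next three lemmas make the definitional identifications of powers explicit, so that
every factor is recognisably a comonoid morphism. -/
theorem tpowAdd_zero_hom (X : C) (m : ℕ) :
    (tpowAdd X m 0).hom = (ρ_ (tpow X m)).inv ≫ (𝟙 _ ⊗ₘ (tpowZero X).inv) := by
  rw [id_tensorHom]
  exact (Category.comp_id _).symm.trans (congrArg (fun k => (ρ_ (tpow X m)).inv ≫ k)
    (MonoidalCategory.whiskerLeft_id _ _).symm)

theorem tpowAdd_succ_hom (X : C) (m n : ℕ) :
    (tpowAdd X m (n + 1)).hom = (tpowSucc X (m + n)).hom ≫ ((tpowAdd X m n).hom ⊗ₘ 𝟙 X) ≫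
      (α_ (tpow X m) (tpow X n) X).hom ≫ (𝟙 _ ⊗ₘ (tpowSucc X n).inv) := by
  have h : (α_ (tpow X m) (tpow X n) X).hom ≫ (𝟙 (tpow X m) ⊗ₘ 𝟙 (tpow X n ⊗ X)) =
    (α_ (tpow X m) (tpow X n) X).hom := by simp
  rw [tensorHom_id]
  refine Eq.trans ?_ (Category.id_comp _).symm
  exact congrArg (fun k => (tpowAdd X m n).hom ▷ X ≫ k) h.symm

theorem tpowOne_hom_eq (X : C) :
    (tpowOne X).hom = (tpowSucc X 0).hom ≫ ((tpowZero X).hom ⊗ₘ 𝟙 X) ≫ (λ_ X).hom := by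
  rw [tensorHom_id]
  refine Eq.trans ?_ (Category.id_comp _).symm
  refine (Category.id_comp (λ_ X).hom).symm.trans ?_
  exact congrArg (fun k => k ≫ (λ_ X).hom) (id_whiskerRight _ _).symm

theorem tpowTwo_hom_eq (X : C) :
    (tpowTwo X).hom = (tpowSucc X 1).hom ≫ ((tpowOne X).hom ⊗ₘ 𝟙 X) := by
  rw [tensorHom_id]
  exact (Category.id_comp _).symm

end Defs

variable {C : Type u} [Category.{v} C] [MonoidalCategory C] [SymmetricCategory C]

attribute [local instance] ComonObj.instTensorUnit

instance tpowComonObj (X : C) [ComonObj X] : (n : ℕ) → ComonObj (tpow X n)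
  | 0 => inferInstanceAs (ComonObj (𝟙_ C))
  | n + 1 => letI := tpowComonObj X n; inferInstanceAs (ComonObj (tpow X n ⊗ X))

instance tpow_isCommComonObj (X : C) [ComonObj X] [IsCommComonObj X] :
    (n : ℕ) → IsCommComonObj (tpow X n)
  | 0 => inferInstanceAs (IsCommComonObj (𝟙_ C))
  | n + 1 => letI := tpow_isCommComonObj X n; inferInstanceAs (IsCommComonObj (tpow X n ⊗ X))

instance tpowSucc_hom_isComonHom (X : C) [ComonObj X] (n : ℕ) : IsComonHom (tpowSucc X n).hom :=
  inferInstanceAs (IsComonHom (𝟙 (tpow X n ⊗ X)))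

instance tpowZero_hom_isComonHom (X : C) [ComonObj X] : IsComonHom (tpowZero X).hom :=
  inferInstanceAs (IsComonHom (𝟙 (𝟙_ C)))

/-- The projection of `X^n` onto its `i`-th factor. -/
def tpowProj (X : C) [ComonObj X] : (n : ℕ) → Fin n → (tpow X n ⟶ X)
  | 0 => Fin.elim0
  | n + 1 => Fin.lastCases ((tpowSucc X n).hom ≫ comonSnd (tpow X n) X)
      fun i => (tpowSucc X n).hom ≫ comonFst (tpow X n) X ≫ tpowProj X n i

@[simp]
theorem tpowProj_last (X : C) [ComonObj X] (n : ℕ) :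
    tpowProj X (n + 1) (Fin.last n) = (tpowSucc X n).hom ≫ comonSnd (tpow X n) X := by
  simp [tpowProj]

@[simp]
theorem tpowProj_castSucc (X : C) [ComonObj X] (n : ℕ) (i : Fin n) :
    tpowProj X (n + 1) i.castSucc =
      (tpowSucc X n).hom ≫ comonFst (tpow X n) X ≫ tpowProj X n i := by
  simp [tpowProj]

theorem tpow_hom_ext (X : C) [ComonObj X] {n : ℕ} {A : C} [ComonObj A] {f g : A ⟶ tpow X n}
    [IsComonHom f] [IsComonHom g] (h : ∀ i, f ≫ tpowProj X n i = g ≫ tpowProj X n i) : f = g := by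
  induction n with
  | zero =>
    -- The unit object is terminal among comonoids, as its own counit is the identity.
    have key (k : A ⟶ tpow X 0) [IsComonHom k] : k ≫ (tpowZero X).hom = ε[A] := by
      rw [← IsComonHom.hom_counit (k ≫ (tpowZero X).hom)]
      exact (Category.comp_id _).symm
    rw [← cancel_mono (tpowZero X).hom, key f, key g]
  | succ n ih =>
    rw [← cancel_mono (tpowSucc X n).hom]
    apply IsComonHom.hom_ext_tensor
    · exact ih fun i => by simpa using h i.castSucc
    · simpa using h (Fin.last n)

instance tpowAdd_hom_isComonHom (X : C) [ComonObj X] (m : ℕ) :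
    (n : ℕ) → IsComonHom (tpowAdd X m n).hom
  | 0 => by rw [tpowAdd_zero_hom]; infer_instance
  | n + 1 => by
    have := tpowAdd_hom_isComonHom X m n
    rw [tpowAdd_succ_hom]
    infer_instance

theorem tpowAdd_hom_comonFst (X : C) [ComonObj X] (m n : ℕ) (i : Fin m) :
    (tpowAdd X m n).hom ≫ comonFst _ _ ≫ tpowProj X m i = tpowProj X (m + n) (Fin.castAdd n i) := by
  induction n with
  | zero =>
    rw [tpowAdd_zero_hom, Category.assoc, tensorHom_comonFst_assoc]
    simp [comonFst]
  | succ n ih =>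
    rw [tpowAdd_succ_hom]
    simp only [Category.assoc]
    rw [tensorHom_comonFst_assoc, Category.id_comp, reassoc_of% associator_hom_comonFst,
      tensorHom_comonFst_assoc, ih]
    exact (tpowProj_castSucc X (m + n) (Fin.castAdd n i)).symm

theorem tpowAdd_hom_comonSnd (X : C) [ComonObj X] (m n : ℕ) (i : Fin n) :
    (tpowAdd X m n).hom ≫ comonSnd _ _ ≫ tpowProj X n i = tpowProj X (m + n) (Fin.natAdd m i) := by
  induction n with
  | zero => exact i.elim0
  | succ n ih =>
    rw [tpowAdd_succ_hom]
    simp only [Category.assoc]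
    rw [tensorHom_comonSnd_assoc]
    induction i using Fin.lastCases with
    | last =>
      rw [tpowProj_last, Iso.inv_hom_id_assoc, associator_hom_comonSnd_comonSnd,
        tensorHom_comonSnd, Category.comp_id]
      exact (tpowProj_last X (m + n)).symm
    | cast i =>
      rw [tpowProj_castSucc, Iso.inv_hom_id_assoc, reassoc_of% associator_hom_comonSnd_comonFst,
        tensorHom_comonFst_assoc, ih]
      exact (tpowProj_castSucc X (m + n) (Fin.natAdd m i)).symm

instance tpowOne_hom_isComonHom (X : C) [ComonObj X] : IsComonHom (tpowOne X).hom := by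
  rw [tpowOne_hom_eq]; infer_instance

instance tpowTwo_hom_isComonHom (X : C) [ComonObj X] : IsComonHom (tpowTwo X).hom := by
  rw [tpowTwo_hom_eq]; infer_instance

theorem tpowProj_one (X : C) [ComonObj X] : tpowProj X 1 0 = (tpowOne X).hom := by
  rw [tpowOne_hom_eq]
  refine (tpowProj_last X 0).trans ?_
  rw [comonSnd, tensorHom_id]
  rfl

theorem tpowProj_two_zero (X : C) [ComonObj X] :
    tpowProj X 2 0 = (tpowTwo X).hom ≫ comonFst X X := by
  refine (tpowProj_castSucc X 1 0).trans ?_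
  rw [tpowTwo_hom_eq, Category.assoc, tensorHom_comonFst, tpowProj_one]

theorem tpowProj_two_one (X : C) [ComonObj X] :
    tpowProj X 2 1 = (tpowTwo X).hom ≫ comonSnd X X := by
  refine (tpowProj_last X 1).trans ?_
  rw [tpowTwo_hom_eq, Category.assoc, tensorHom_comonSnd, Category.comp_id]

section Eval
variable (X : C) [BimonObj X]

instance eval_isComonHom [IsCommComonObj X] {m n : ℕ} (d : BialgDiagram m n) :
    IsComonHom (d.eval X) := by
  induction d with
  | id n => exact inferInstanceAs (IsComonHom (𝟙 (tpow X n)))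
  | swap => exact inferInstanceAs (IsComonHom ((tpowTwo X).hom ≫ (β_ X X).hom ≫ (tpowTwo X).inv))
  | mul => exact inferInstanceAs (IsComonHom ((tpowTwo X).hom ≫ μ[X] ≫ (tpowOne X).inv))
  | unit => exact inferInstanceAs (IsComonHom (η[X] ≫ (tpowOne X).inv))
  | comul => exact inferInstanceAs (IsComonHom ((tpowOne X).hom ≫ Δ[X] ≫ (tpowTwo X).inv))
  | counit => exact inferInstanceAs (IsComonHom ((tpowOne X).hom ≫ ε[X]))
  | comp d e hd he => exact inferInstanceAs (IsComonHom (d.eval X ≫ e.eval X))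
  | tensor d e hd he => exact inferInstanceAs (IsComonHom
      ((tpowAdd X _ _).hom ≫ (d.eval X ⊗ₘ e.eval X) ≫ (tpowAdd X _ _).inv))

end Eval

end BialgDiagram

/-! ### Paths in the graph of a diagram -/

namespace BialgDiagram

open Quiver

theorem input_tensor_castAdd {m n m' n' : ℕ} (d : BialgDiagram m n) (e : BialgDiagram m' n')
    (i : Fin m) : input (d.tensor e) (Fin.castAdd m' i) = Sum.inl (input d i) :=
  Fin.addCases_left (motive := fun _ => Vertex d ⊕ Vertex e)
    (left := fun i => Sum.inl (input d i)) (right := fun i => Sum.inr (input e i)) i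

theorem input_tensor_natAdd {m n m' n' : ℕ} (d : BialgDiagram m n) (e : BialgDiagram m' n')
    (i : Fin m') : input (d.tensor e) (Fin.natAdd m i) = Sum.inr (input e i) :=
  Fin.addCases_right (motive := fun _ => Vertex d ⊕ Vertex e)
    (left := fun i => Sum.inl (input d i)) (right := fun i => Sum.inr (input e i)) i

theorem output_tensor_castAdd {m n m' n' : ℕ} (d : BialgDiagram m n) (e : BialgDiagram m' n')
    (i : Fin n) : output (d.tensor e) (Fin.castAdd n' i) = Sum.inl (output d i) :=
  Fin.addCases_left (motive := fun _ => Vertex d ⊕ Vertex e)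
    (left := fun i => Sum.inl (output d i)) (right := fun i => Sum.inr (output e i)) i

theorem output_tensor_natAdd {m n m' n' : ℕ} (d : BialgDiagram m n) (e : BialgDiagram m' n')
    (i : Fin n') : output (d.tensor e) (Fin.natAdd n i) = Sum.inr (output e i) :=
  Fin.addCases_right (motive := fun _ => Vertex d ⊕ Vertex e)
    (left := fun i => Sum.inl (output d i)) (right := fun i => Sum.inr (output e i)) i

/-- Ensures that an edge between the two halves of a composite determines its middle wire, so that a
path splits in only one way. -/
theorem output_injective {m n : ℕ} (d : BialgDiagram m n) : Function.Injective (output d) := by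
  induction d with
  | comp d e hd he => exact Sum.inr_injective.comp he
  | tensor d e hd he =>
    intro i j h
    induction i using Fin.addCases with
    | left i =>
      replace h := (output_tensor_castAdd d e i).symm.trans h
      induction j using Fin.addCases with
      | left j => rw [hd (Sum.inl.inj (h.trans (output_tensor_castAdd d e j)))]
      | right j => exact (Sum.inl_ne_inr (h.trans (output_tensor_natAdd d e j))).elim
    | right i =>
      replace h := (output_tensor_natAdd d e i).symm.trans h
      induction j using Fin.addCases with
      | left j => exact (Sum.inr_ne_inl (h.trans (output_tensor_castAdd d e j))).elim
      | right j => rw [he (Sum.inr.inj (h.trans (output_tensor_natAdd d e j)))]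
  | _ => exact Sum.inr_injective

/-! ### Splitting paths of a composite -/

section Comp

variable {l m n : ℕ} {d : BialgDiagram l m} {e : BialgDiagram m n}

/-- The first diagram of a composite, as a part of its graph. -/
def compInl (d : BialgDiagram l m) (e : BialgDiagram m n) : Point d ⥤q Point (d.comp e) where
  obj x := ⟨Sum.inl x.pt⟩
  map h := ⟨Or.inl ⟨_, _, h.down, rfl, rfl⟩⟩

/-- The second diagram of a composite, as a part of its graph. -/
def compInr (d : BialgDiagram l m) (e : BialgDiagram m n) : Point e ⥤q Point (d.comp e) where
  obj x := ⟨Sum.inr x.pt⟩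
  map h := ⟨Or.inr (Or.inl ⟨_, _, h.down, rfl, rfl⟩)⟩

/-- The edge of a composite along its `k`-th middle wire. -/
def compWire (d : BialgDiagram l m) (e : BialgDiagram m n) (k : Fin m) :
    (compInl d e).obj ⟨output d k⟩ ⟶ (compInr d e).obj ⟨input e k⟩ :=
  ⟨Or.inr (Or.inr ⟨k, rfl, rfl⟩)⟩

theorem adj_comp_inl_inl {a b : Vertex d} :
    Adj (d.comp e) (Sum.inl a) (Sum.inl b) ↔ Adj d a b := by
  refine ⟨?_, fun h => Or.inl ⟨a, b, h, rfl, rfl⟩⟩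
  rintro (⟨x, y, h, hx, hy⟩ | ⟨_, _, _, hx, _⟩ | ⟨_, _, hy⟩)
  · rwa [Sum.inl.inj hx, Sum.inl.inj hy]
  · exact (Sum.inl_ne_inr hx).elim
  · exact (Sum.inl_ne_inr hy).elim

theorem adj_comp_inr_inr {a b : Vertex e} :
    Adj (d.comp e) (Sum.inr a) (Sum.inr b) ↔ Adj e a b := by
  refine ⟨?_, fun h => Or.inr (Or.inl ⟨a, b, h, rfl, rfl⟩)⟩
  rintro (⟨_, _, _, hx, _⟩ | ⟨x, y, h, hx, hy⟩ | ⟨_, hx, _⟩)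
  · exact (Sum.inr_ne_inl hx).elim
  · rwa [Sum.inr.inj hx, Sum.inr.inj hy]
  · exact (Sum.inr_ne_inl hx).elim

theorem adj_comp_inl_inr {a : Vertex d} {b : Vertex e} :
    Adj (d.comp e) (Sum.inl a) (Sum.inr b) ↔ ∃ k, a = output d k ∧ b = input e k := by
  refine ⟨?_, ?_⟩
  · rintro (⟨_, _, _, _, hy⟩ | ⟨_, _, _, hx, _⟩ | ⟨k, hx, hy⟩)
    · exact (Sum.inr_ne_inl hy).elim
    · exact (Sum.inl_ne_inr hx).elim
    · exact ⟨k, Sum.inl.inj hx, Sum.inr.inj hy⟩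
  · rintro ⟨k, rfl, rfl⟩
    exact Or.inr (Or.inr ⟨k, rfl, rfl⟩)

theorem not_adj_comp_inr_inl {a : Vertex d} {b : Vertex e} :
    ¬ Adj (d.comp e) (Sum.inr b) (Sum.inl a) := by
  simp [Adj]

/-- Paths in a composite starting in the first diagram, split at the middle wires. -/
def CompPath (d : BialgDiagram l m) (e : BialgDiagram m n) (a : Point d) :
    Vertex d ⊕ Vertex e → Type
  | .inl b => Path a ⟨b⟩
  | .inr b => Σ k, Path a ⟨output d k⟩ × Path (Point.mk (input e k)) ⟨b⟩

/-- Extending a split path by an edge. -/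
noncomputable def CompPath.cons {a : Point d} : (u v : Vertex d ⊕ Vertex e) →
    Adj (d.comp e) u v → CompPath d e a u → CompPath d e a v
  | .inl _, .inl _, h, p => Path.cons p ⟨adj_comp_inl_inl.1 h⟩
  | .inl _, .inr _, h, p =>
    let h' := adj_comp_inl_inr.1 h
    ⟨h'.choose, h'.choose_spec.1 ▸ p, h'.choose_spec.2 ▸ Path.nil⟩
  | .inr _, .inr _, h, ⟨k, p, q⟩ => ⟨k, p, Path.cons q ⟨adj_comp_inr_inr.1 h⟩⟩
  | .inr _, .inl _, h, _ => (not_adj_comp_inr_inl h).elim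

theorem CompPath.cons_wire {a : Point d} (k : Fin m)
    (h : Adj (d.comp e) (Sum.inl (output d k)) (Sum.inr (input e k))) (p : Path a ⟨output d k⟩) :
    CompPath.cons (d := d) (e := e) (.inl (output d k)) (.inr (input e k)) h p =
      ⟨k, p, Path.nil⟩ := by
  -- `CompPath.cons` selects the wire by choice; with an arbitrary `k'` in its place, injectivity of
  -- the outputs forces `k' = k` and the casts vanish.
  have key (k' : Fin m) (h₁ : output d k = output d k') (h₂ : input e k = input e k') :
      (⟨k', h₁ ▸ p, h₂ ▸ Path.nil⟩ :
        Σ k', Path a ⟨output d k'⟩ × Path (Point.mk (input e k')) ⟨input e k⟩) =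
      ⟨k, p, Path.nil⟩ := by
    obtain rfl := output_injective d h₁
    rfl
  exact key _ _ _

/-- Splitting a path of a composite. -/
noncomputable def splitPath {a : Point d} :
    {v : Point (d.comp e)} → Path ((compInl d e).obj a) v → CompPath d e a v.pt
  | _, .nil => (Path.nil : Path a a)
  | _, .cons p h => CompPath.cons _ _ h.down (splitPath p)

/-- Joining the two parts of a split path. -/
def joinPath {a : Point d} : (v : Vertex d ⊕ Vertex e) → CompPath d e a v →
    Path ((compInl d e).obj a) (Point.mk v)
  | .inl _, p => (compInl d e).mapPath p
  | .inr _, ⟨k, p, q⟩ =>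
    (((compInl d e).mapPath p).cons (compWire d e k)).comp ((compInr d e).mapPath q)

theorem joinPath_cons {a : Point d} (u v : Vertex d ⊕ Vertex e) (h : Adj (d.comp e) u v)
    (p : CompPath d e a u) :
    joinPath v (p.cons u v h) = (joinPath u p).cons (PLift.up h) := by
  match u, v with
  | .inl _, .inl _ => rfl
  | .inl b, .inr c =>
    simp only [CompPath.cons, joinPath]
    generalize_proofs h₁ h₂ h₃
    generalize h₁.choose = k at *
    subst h₂ h₃
    rfl
  | .inr _, .inr _ => rfl
  | .inr _, .inl _ => exact (not_adj_comp_inr_inl h).elim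

theorem joinPath_splitPath {a : Point d} {v : Point (d.comp e)}
    (p : Path ((compInl d e).obj a) v) : joinPath v.pt (splitPath p) = p := by
  induction p with
  | nil => rfl
  | cons p h ih =>
    exact (joinPath_cons _ _ h.down (splitPath p)).trans (congrArg (fun q => Path.cons q h) ih)

theorem splitPath_mapPath {a b : Point d} (p : Path a b) :
    splitPath ((compInl d e).mapPath p) = p := by
  induction p with
  | nil => rfl
  | cons p h ih =>
    change CompPath.cons _ _ _ (splitPath ((compInl d e).mapPath p)) = _
    rw [ih]
    rfl

theorem splitPath_joinPath {a : Point d} (b : Point e) (k : Fin m) (p : Path a ⟨output d k⟩)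
    (q : Path (Point.mk (input e k)) b) :
    splitPath (joinPath (.inr b.pt) ⟨k, p, q⟩) = ⟨k, p, q⟩ := by
  induction q with
  | nil =>
    change CompPath.cons _ _ _ (splitPath ((compInl d e).mapPath p)) = _
    rw [splitPath_mapPath]
    exact CompPath.cons_wire k _ p
  | cons q h ih =>
    change CompPath.cons _ _ _ (splitPath (joinPath (.inr _) ⟨k, p, q⟩)) = _
    rw [ih]
    rfl

/-- A path through a composite passes through exactly one middle wire. -/
noncomputable def compPathEquiv (d : BialgDiagram l m) (e : BialgDiagram m n) (i : Fin l)
    (j : Fin n) :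
    Path (Point.mk (input (d.comp e) i)) (Point.mk (output (d.comp e) j)) ≃
      Σ k, Path (Point.mk (input d i)) (Point.mk (output d k)) ×
        Path (Point.mk (input e k)) (Point.mk (output e j)) where
  toFun p := splitPath (a := ⟨input d i⟩) p
  invFun p := joinPath (.inr (output e j)) p
  left_inv p := joinPath_splitPath (a := ⟨input d i⟩) p
  right_inv _ := splitPath_joinPath _ _ _ _

end Comp

/-! ### Paths of a juxtaposition -/

section Tensor

variable {m n m' n' : ℕ} {e : BialgDiagram m' n'} {d : BialgDiagram m n}

/-- Paths in a juxtaposition are paths in one of the two parts. -/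
def TensorPath (d : BialgDiagram m n) (e : BialgDiagram m' n') :
    Vertex d ⊕ Vertex e → Vertex d ⊕ Vertex e → Type
  | .inl a, .inl b => Path (Point.mk a) (Point.mk b)
  | .inr a, .inr b => Path (Point.mk a) (Point.mk b)
  | .inl _, .inr _ => Empty
  | .inr _, .inl _ => Empty

/-- The left diagram of a juxtaposition, as a part of its graph. -/
def tensorInl (d : BialgDiagram m n) (e : BialgDiagram m' n') :
    Point d ⥤q Point (d.tensor e) where
  obj x := ⟨Sum.inl x.pt⟩
  map h := ⟨Or.inl ⟨_, _, h.down, rfl, rfl⟩⟩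

/-- The right diagram of a juxtaposition, as a part of its graph. -/
def tensorInr (d : BialgDiagram m n) (e : BialgDiagram m' n') :
    Point e ⥤q Point (d.tensor e) where
  obj x := ⟨Sum.inr x.pt⟩
  map h := ⟨Or.inr ⟨_, _, h.down, rfl, rfl⟩⟩

theorem adj_tensor_inl_inl {a b : Vertex d} :
    Adj (d.tensor e) (Sum.inl a) (Sum.inl b) ↔ Adj d a b := by
  refine ⟨?_, fun h => Or.inl ⟨a, b, h, rfl, rfl⟩⟩
  rintro (⟨x, y, h, hx, hy⟩ | ⟨_, _, _, hx, _⟩)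
  · rwa [Sum.inl.inj hx, Sum.inl.inj hy]
  · exact (Sum.inl_ne_inr hx).elim

theorem adj_tensor_inr_inr {a b : Vertex e} :
    Adj (d.tensor e) (Sum.inr a) (Sum.inr b) ↔ Adj e a b := by
  refine ⟨?_, fun h => Or.inr ⟨a, b, h, rfl, rfl⟩⟩
  rintro (⟨_, _, _, hx, _⟩ | ⟨x, y, h, hx, hy⟩)
  · exact (Sum.inr_ne_inl hx).elim
  · rwa [Sum.inr.inj hx, Sum.inr.inj hy]

theorem not_adj_tensor_inl_inr {a : Vertex d} {b : Vertex e} :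
    ¬ Adj (d.tensor e) (Sum.inl a) (Sum.inr b) := by
  simp [Adj]

theorem not_adj_tensor_inr_inl {a : Vertex d} {b : Vertex e} :
    ¬ Adj (d.tensor e) (Sum.inr b) (Sum.inl a) := by
  simp [Adj]

/-- The trivial path in a part. -/
def TensorPath.nil : (u : Vertex d ⊕ Vertex e) → TensorPath d e u u
  | .inl _ => Path.nil
  | .inr _ => Path.nil

/-- Extending a path in a part by an edge. -/
def TensorPath.cons : (t u v : Vertex d ⊕ Vertex e) → Adj (d.tensor e) u v →
    TensorPath d e t u → TensorPath d e t v
  | .inl _, .inl _, .inl _, h, p => Path.cons p ⟨adj_tensor_inl_inl.1 h⟩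
  | .inr _, .inr _, .inr _, h, p => Path.cons p ⟨adj_tensor_inr_inr.1 h⟩
  | _, .inl _, .inr _, h, _ => (not_adj_tensor_inl_inr h).elim
  | _, .inr _, .inl _, h, _ => (not_adj_tensor_inr_inl h).elim

/-- A path of a juxtaposition, as a path in a part. -/
def restrictPath {u : Point (d.tensor e)} :
    {v : Point (d.tensor e)} → Path u v → TensorPath d e u.pt v.pt
  | _, .nil => TensorPath.nil _
  | _, .cons p h => TensorPath.cons _ _ _ h.down (restrictPath p)

/-- A path in a part, as a path of a juxtaposition. -/
def extendPath : (u v : Vertex d ⊕ Vertex e) → TensorPath d e u v →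
    Path (Point.mk u : Point (d.tensor e)) (Point.mk v)
  | .inl _, .inl _, p => (tensorInl d e).mapPath p
  | .inr _, .inr _, p => (tensorInr d e).mapPath p

theorem extendPath_cons (t u v : Vertex d ⊕ Vertex e) (h : Adj (d.tensor e) u v)
    (p : TensorPath d e t u) :
    extendPath t v (p.cons t u v h) = (extendPath t u p).cons (PLift.up h) := by
  match t, u, v, h, p with
  | .inl _, .inl _, .inl _, h, p => rfl
  | .inr _, .inr _, .inr _, h, p => rfl
  | _, .inl _, .inr _, h, _ => exact (not_adj_tensor_inl_inr h).elim
  | _, .inr _, .inl _, h, _ => exact (not_adj_tensor_inr_inl h).elim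

theorem extendPath_restrictPath {u v : Point (d.tensor e)} (p : Path u v) :
    extendPath u.pt v.pt (restrictPath p) = p := by
  induction p with
  | nil => rcases u with ⟨_ | _⟩ <;> rfl
  | cons p h ih =>
    exact (extendPath_cons _ _ _ h.down (restrictPath p)).trans
      (congrArg (fun q => Path.cons q h) ih)

theorem restrictPath_mapPath_inl {a b : Point d} (p : Path a b) :
    restrictPath ((tensorInl d e).mapPath p) = p := by
  induction p with
  | nil => rfl
  | cons p h ih =>
    change TensorPath.cons _ _ _ _ (restrictPath ((tensorInl d e).mapPath p)) = _
    rw [ih]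
    rfl

theorem restrictPath_mapPath_inr {a b : Point e} (p : Path a b) :
    restrictPath ((tensorInr d e).mapPath p) = p := by
  induction p with
  | nil => rfl
  | cons p h ih =>
    change TensorPath.cons _ _ _ _ (restrictPath ((tensorInr d e).mapPath p)) = _
    rw [ih]
    rfl

/-- Paths in a juxtaposition are paths in one of the two parts. -/
def tensorPathEquiv (u v : Vertex d ⊕ Vertex e) :
    Path (Point.mk u : Point (d.tensor e)) (Point.mk v) ≃ TensorPath d e u v where
  toFun p := restrictPath p
  invFun p := extendPath u v p
  left_inv p := extendPath_restrictPath p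
  right_inv p := match u, v, p with
    | .inl _, .inl _, p => restrictPath_mapPath_inl p
    | .inr _, .inr _, p => restrictPath_mapPath_inr p

end Tensor

/-- In a graph without paths of length two, paths between distinct points are edges. -/
def pathEquivAdj {m n : ℕ} (d : BialgDiagram m n) (h : ∀ x y z, Adj d x y → ¬ Adj d y z)
    {x y : Vertex d} (hxy : x ≠ y) :
    Path (Point.mk x) (Point.mk y) ≃ PLift (Adj d x y) where
  toFun p := ⟨by
    cases p with
    | nil => exact (hxy rfl).elim
    | cons p f =>
      cases p with
      | nil => exact f.down
      | cons p g => exact (h _ _ _ g.down f.down).elim⟩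
  invFun f := Path.cons Path.nil f
  left_inv p := by
    cases p with
    | nil => exact (hxy rfl).elim
    | cons p f =>
      cases p with
      | nil => rfl
      | cons p g => exact (h _ _ _ g.down f.down).elim
  right_inv _ := rfl

end BialgDiagram

/-! ### Computing characteristic matrices -/

namespace BialgDiagram

open Quiver

theorem card_path_of_adj {m n : ℕ} (d : BialgDiagram m n) (h : ∀ x y z, Adj d x y → ¬ Adj d y z)
    {x y : Vertex d} (hxy : x ≠ y) (hadj : Adj d x y) :
    Nat.card (Path (Point.mk x) (Point.mk y)) = 1 := by
  have : Unique (PLift (Adj d x y)) := ⟨⟨⟨hadj⟩⟩, fun _ => rfl⟩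
  rw [Nat.card_congr (pathEquivAdj d h hxy), Nat.card_unique]

theorem card_path_of_not_adj {m n : ℕ} (d : BialgDiagram m n)
    (h : ∀ x y z, Adj d x y → ¬ Adj d y z) {x y : Vertex d} (hxy : x ≠ y) (hadj : ¬ Adj d x y) :
    Nat.card (Path (Point.mk x) (Point.mk y)) = 0 := by
  have : IsEmpty (PLift (Adj d x y)) := ⟨fun h => hadj h.down⟩
  rw [Nat.card_congr (pathEquivAdj d h hxy), Nat.card_of_isEmpty]

theorem not_adj_id (n : ℕ) (x y z : Vertex (.id n)) (h : Adj (.id n) x y) : ¬ Adj (.id n) y z := by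
  obtain ⟨i, -, hy⟩ := h
  rintro ⟨j, hy', -⟩
  exact Sum.inl_ne_inr (hy'.symm.trans hy)

theorem not_adj_swap (x y z : Vertex .swap) (h : Adj .swap x y) : ¬ Adj .swap y z := by
  obtain ⟨i, -, hy⟩ := h
  rintro ⟨j, hy', -⟩
  exact Sum.inl_ne_inr (hy'.symm.trans hy)

theorem not_adj_mul (x y z : Vertex .mul) (h : Adj .mul x y) : ¬ Adj .mul y z := by
  obtain ⟨i, j, -, hy⟩ := h
  rintro ⟨k, l, hy', -⟩
  exact Sum.inl_ne_inr (hy'.symm.trans hy)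

theorem not_adj_comul (x y z : Vertex .comul) (h : Adj .comul x y) : ¬ Adj .comul y z := by
  obtain ⟨i, j, -, hy⟩ := h
  rintro ⟨k, l, hy', -⟩
  exact Sum.inl_ne_inr (hy'.symm.trans hy)

theorem charMatrix_id (n : ℕ) : (BialgDiagram.id n).charMatrix = 1 := by
  ext i j
  by_cases h : i = j
  · subst h
    rw [Matrix.one_apply_eq]
    exact card_path_of_adj _ (not_adj_id n) Sum.inl_ne_inr ⟨i, rfl, rfl⟩
  · rw [Matrix.one_apply_ne h]
    refine card_path_of_not_adj _ (not_adj_id n) Sum.inl_ne_inr ?_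
    rintro ⟨k, hi, hj⟩
    exact h ((Sum.inl.inj hi).trans (Sum.inr.inj hj).symm)

theorem charMatrix_swap_apply_rev (i : Fin 2) :
    BialgDiagram.swap.charMatrix i i.rev = 1 :=
  card_path_of_adj _ not_adj_swap Sum.inl_ne_inr ⟨i, rfl, rfl⟩

theorem charMatrix_swap_apply_self (i : Fin 2) :
    BialgDiagram.swap.charMatrix i i = 0 := by
  refine card_path_of_not_adj _ not_adj_swap Sum.inl_ne_inr ?_
  rintro ⟨k, hi, hj⟩
  have hi : i = k := Sum.inl.inj hi
  have hj : i = k.rev := Sum.inr.inj hj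
  subst hi
  revert hj
  fin_cases i <;> decide

theorem charMatrix_mul_apply (i : Fin 2) (j : Fin 1) : BialgDiagram.mul.charMatrix i j = 1 :=
  card_path_of_adj _ not_adj_mul Sum.inl_ne_inr ⟨i, j, rfl, rfl⟩

theorem charMatrix_comul_apply (i : Fin 1) (j : Fin 2) : BialgDiagram.comul.charMatrix i j = 1 :=
  card_path_of_adj _ not_adj_comul Sum.inl_ne_inr ⟨i, j, rfl, rfl⟩

section Tensor

variable {m n m' n' : ℕ} (d : BialgDiagram m n) (e : BialgDiagram m' n')

/-- The endpoints `u`, `v` are free because `Fin.addCases` identifies the inputs and outputs of a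
juxtaposition only up to propositional equality. -/
theorem card_path_tensor (i : Fin (m + m')) (j : Fin (n + n')) (u v : Vertex d ⊕ Vertex e)
    (hu : input (d.tensor e) i = u) (hv : output (d.tensor e) j = v) :
    (d.tensor e).charMatrix i j = Nat.card (TensorPath d e u v) := by
  subst hu hv
  exact Nat.card_congr (tensorPathEquiv _ _)

theorem charMatrix_tensor_castAdd_castAdd (i : Fin m) (j : Fin n) :
    (d.tensor e).charMatrix (Fin.castAdd m' i) (Fin.castAdd n' j) = d.charMatrix i j :=
  card_path_tensor d e _ _ _ _ (input_tensor_castAdd d e i) (output_tensor_castAdd d e j)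

theorem charMatrix_tensor_natAdd_natAdd (i : Fin m') (j : Fin n') :
    (d.tensor e).charMatrix (Fin.natAdd m i) (Fin.natAdd n j) = e.charMatrix i j :=
  card_path_tensor d e _ _ _ _ (input_tensor_natAdd d e i) (output_tensor_natAdd d e j)

theorem charMatrix_tensor_castAdd_natAdd (i : Fin m) (j : Fin n') :
    (d.tensor e).charMatrix (Fin.castAdd m' i) (Fin.natAdd n j) = 0 :=
  (card_path_tensor d e _ _ _ _ (input_tensor_castAdd d e i) (output_tensor_natAdd d e j)).trans
    (Nat.card_of_isEmpty (α := Empty))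

theorem charMatrix_tensor_natAdd_castAdd (i : Fin m') (j : Fin n) :
    (d.tensor e).charMatrix (Fin.natAdd m i) (Fin.castAdd n' j) = 0 :=
  (card_path_tensor d e _ _ _ _ (input_tensor_natAdd d e i) (output_tensor_castAdd d e j)).trans
    (Nat.card_of_isEmpty (α := Empty))

end Tensor

theorem finite_path_of_ne {m n : ℕ} (d : BialgDiagram m n) (h : ∀ x y z, Adj d x y → ¬ Adj d y z)
    {x y : Vertex d} (hxy : x ≠ y) : Finite (Path (Point.mk x) (Point.mk y)) :=
  Finite.of_equiv _ (pathEquivAdj d h hxy).symm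

/-- `Nat.card` is `0` on infinite types, so finiteness is needed before counts of paths may be
summed over the middle wires. -/
theorem finite_path {m n : ℕ} (d : BialgDiagram m n) (i : Fin m) (j : Fin n) :
    Finite (Path (Point.mk (input d i)) (Point.mk (output d j))) := by
  induction d with
  | id n => exact finite_path_of_ne _ (not_adj_id n) Sum.inl_ne_inr
  | swap => exact finite_path_of_ne _ not_adj_swap Sum.inl_ne_inr
  | mul => exact finite_path_of_ne _ not_adj_mul Sum.inl_ne_inr
  | unit => exact i.elim0
  | comul => exact finite_path_of_ne _ not_adj_comul Sum.inl_ne_inr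
  | counit => exact j.elim0
  | comp d e hd he =>
    exact Finite.of_equiv _ (compPathEquiv d e i j).symm
  | tensor d e hd he =>
    have key (u v : Vertex d ⊕ Vertex e) (hu : input (d.tensor e) i = u)
        (hv : output (d.tensor e) j = v) (h : Finite (TensorPath d e u v)) :
        Finite (Path (Point.mk (input (d.tensor e) i)) (Point.mk (output (d.tensor e) j))) := by
      subst hu hv
      exact Finite.of_equiv _ (tensorPathEquiv _ _).symm
    induction i using Fin.addCases with
    | left i =>
      induction j using Fin.addCases with
      | left j => exact key _ _ (input_tensor_castAdd d e i) (output_tensor_castAdd d e j) (hd i j)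
      | right j =>
        exact key _ _ (input_tensor_castAdd d e i) (output_tensor_natAdd d e j)
          (inferInstanceAs (Finite Empty))
    | right i =>
      induction j using Fin.addCases with
      | left j =>
        exact key _ _ (input_tensor_natAdd d e i) (output_tensor_castAdd d e j)
          (inferInstanceAs (Finite Empty))
      | right j => exact key _ _ (input_tensor_natAdd d e i) (output_tensor_natAdd d e j) (he i j)

theorem charMatrix_comp {l m n : ℕ} (d : BialgDiagram l m) (e : BialgDiagram m n) :
    (d.comp e).charMatrix = d.charMatrix * e.charMatrix := by
  ext i j
  have (k : Fin m) := finite_path d i k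
  have (k : Fin m) := finite_path e k j
  refine (Nat.card_congr (compPathEquiv d e i j)).trans ?_
  rw [Nat.card_sigma, Matrix.mul_apply]
  exact Finset.sum_congr rfl fun k _ => Nat.card_prod _ _

/-! ### Components of a diagram as convolution monomials -/

section Eval

attribute [local instance] ComonObj.instTensorUnit

variable {C : Type u} [Category.{v} C] [MonoidalCategory C] [SymmetricCategory C]
variable (X : C) [BimonObj X] [IsCommMonObj X] [IsCommComonObj X]

/-- The value of a diagram is the monomial map with exponent matrix `charMatrix`. -/
theorem of_eval_comp_tpowProj {m n : ℕ} (d : BialgDiagram m n) (j : Fin n) :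
    Conv.of (d.eval X ≫ tpowProj X n j) =
      ∏ i, Conv.of (tpowProj X m i) ^ d.charMatrix i j := by
  induction d with
  | id n =>
    rw [charMatrix_id, Finset.prod_eq_single j]
    · rw [Matrix.one_apply_eq, pow_one, eval, Category.id_comp]
    · intro i _ h
      rw [Matrix.one_apply_ne h, pow_zero]
    · simp
  | swap =>
    rw [Fin.prod_univ_two]
    fin_cases j
    · have h₁ : swap.charMatrix 1 0 = 1 := charMatrix_swap_apply_rev 1
      dsimp only [Fin.zero_eta, Fin.mk_one]
      rw [charMatrix_swap_apply_self, h₁, pow_zero, pow_one, one_mul, tpowProj_two_zero,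
        tpowProj_two_one, eval, Category.assoc, Category.assoc, Iso.inv_hom_id_assoc]
      rw [comonFst, comonSnd, ← BraidedCategory.braiding_naturality_left_assoc,
        braiding_rightUnitor]
    · have h₁ : swap.charMatrix 0 1 = 1 := charMatrix_swap_apply_rev 0
      dsimp only [Fin.zero_eta, Fin.mk_one]
      rw [charMatrix_swap_apply_self, h₁, pow_zero, pow_one, mul_one, tpowProj_two_zero,
        tpowProj_two_one, eval, Category.assoc, Category.assoc, Iso.inv_hom_id_assoc]
      rw [comonFst, comonSnd, ← BraidedCategory.braiding_naturality_right_assoc,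
        braiding_leftUnitor]
  | mul =>
    rw [Fin.prod_univ_two, charMatrix_mul_apply, charMatrix_mul_apply, pow_one, pow_one,
      Subsingleton.elim j 0, tpowProj_one, tpowProj_two_zero, tpowProj_two_one, Conv.of_mul_of,
      -- The convolution of the two projections of `X ⊗ X` is `μ`, since duplicating and then
      -- projecting is the identity.
      ← tensorHom_comp_tensorHom_assoc, ← IsComonHom.hom_comul_assoc,
      reassoc_of% (comul_comonFst_comonSnd X X), eval]
    simp
  | unit =>
    rw [Finset.univ_eq_empty, Finset.prod_empty, Subsingleton.elim j 0, tpowProj_one]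
    -- The empty product is the convolution unit, counit then `η`, and the counit of `X^0` is the
    -- identity.
    have h : (MonObj.one (X := X) ≫ (tpowOne X).inv) ≫ (tpowOne X).hom =
        𝟙 (𝟙_ C) ≫ MonObj.one (X := X) := by simp
    exact h
  | comul =>
    rw [Fin.prod_univ_one, charMatrix_comul_apply, pow_one, tpowProj_one, eval]
    fin_cases j
    · dsimp only [Fin.zero_eta, Fin.mk_one]
      rw [tpowProj_two_zero, Category.assoc, Category.assoc, Iso.inv_hom_id_assoc]
      simp [comonFst]
    · dsimp only [Fin.zero_eta, Fin.mk_one]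
      rw [tpowProj_two_one, Category.assoc, Category.assoc, Iso.inv_hom_id_assoc]
      simp [comonSnd]
  | counit => exact j.elim0
  | @comp k m n d e hd he =>
    -- Precomposition with the value of `d` is a monoid homomorphism; substituting the monomials for
    -- `d` and exchanging the two products gives exponents `∑ k, d i k * e k j`.
    rw [eval, Category.assoc, ← Conv.precomp_of, he, map_prod]
    simp only [map_pow, Conv.precomp_of, hd, ← Finset.prod_pow, ← pow_mul]
    rw [Finset.prod_comm]
    simp only [Finset.prod_pow_eq_pow_sum, charMatrix_comp, Matrix.mul_apply]
  | @tensor m n m' n' d e hd he =>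
    rw [Fin.prod_univ_add, eval, Category.assoc, Category.assoc]
    induction j using Fin.addCases with
    | left j =>
      -- The matrix is block diagonal, so inputs of the other part contribute exponent `0`.
      simp only [charMatrix_tensor_castAdd_castAdd, charMatrix_tensor_natAdd_castAdd, pow_zero,
        Finset.prod_const_one, mul_one]
      rw [← tpowAdd_hom_comonFst, Iso.inv_hom_id_assoc, tensorHom_comonFst_assoc,
        ← Category.assoc, ← Conv.precomp_of, hd, map_prod]
      simp only [map_pow, Conv.precomp_of, Category.assoc, tpowAdd_hom_comonFst]
    | right j =>
      simp only [charMatrix_tensor_castAdd_natAdd, charMatrix_tensor_natAdd_natAdd, pow_zero,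
        Finset.prod_const_one, one_mul]
      rw [← tpowAdd_hom_comonSnd, Iso.inv_hom_id_assoc, tensorHom_comonSnd_assoc,
        ← Category.assoc, ← Conv.precomp_of, he, map_prod]
      simp only [map_pow, Conv.precomp_of, Category.assoc, tpowAdd_hom_comonSnd]

end Eval

end BialgDiagram

theorem mainTheorem6 {C : Type u} [Category.{v} C] [MonoidalCategory C] [SymmetricCategory C]
    (X : C) [BimonObj X] [IsCommMonObj X] [IsCommComonObj X] {m n : ℕ}
    (d e : BialgDiagram m n) (h : d.charMatrix = e.charMatrix) :
    d.eval X = e.eval X :=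
  BialgDiagram.tpow_hom_ext X fun j =>
    (BialgDiagram.of_eval_comp_tpowProj X d j).trans
      (h ▸ (BialgDiagram.of_eval_comp_tpowProj X e j).symm)
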